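/- Let $G$ be a countable discrete group. For a map $\sigma\colon G\to \mathrm{Sym}(m)$ ($m\ge 1$, not necessarily a homomorphism) and $F\subseteq G$, let $V_\sigma(F)\subseteq\{1,\dots,m\}$ be the set of all $v$ such that for all $f_1,f_2\in F$ one has $\sigma(f_1)\sigma(f_2)v=\sigma(f_1f_2)v$, and $\sigma(f_1)v\neq\sigma(f_2)v$ if $f_1\ne f_2$. The group $G$ is *sofic* if there are maps $\sigma_i\colon G\to\mathrm{Sym}(m_i)$ with $m_i\ge 1$ ($i\in\mathbb N$), sets $F_1\subseteq F_2\subseteq\cdots$ with $\bigcup_i F_i=G$, and $\epsilon_i\to 0$, such that $|V_{\sigma_i}(F_i)|\ge(1-\epsilon_i)m_i$ for all $i$. For a standard Borel probability space $(K,\kappa)$, the *Bernoulli shift over $G$ with base $(K,\kappa)$* is the system $(G,K^G,\kappa^G)$, where $K^G$ carries the product Borel structure and the product measure $\kappa^G$, and $G$ acts by $(gx)(f)=x(g^{-1}f)$. The *base entropy* $H(\kappa)\in[0,+\infty]$ is $-\sum_{k\in K'}\kappa(\{k\})\log\kappa(\{k\})$ (with $0\log 0=0$) if there is a countable set $K'\subseteq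 K$ with $\kappa(K')=1$, and $+\infty$ otherwise. Two systems $(G,X,\mu)$ and $(G,Y,\nu)$ are *isomorphic* if there are conull measurable sets $X'\subseteq X$, $Y'\subseteq Y$, with $X'$ being $G$-invariant, and a bijection $\phi\colon X'\to Y'$ with $\phi$ and $\phi^{-1}$ measurable, $\phi_*\mu=\nu$, and $\phi(gx)=g\phi(x)$ for all $g\in G$, $x\in X'$. The group $G$ is *Ornstein* if, for any two standard Borel probability spaces $(K,\kappa)$ and $(L,\lambda)$, $H(\kappa)=H(\lambda)$ implies that $(G,K^G,\kappa^G)$ and $(G,L^G,\lambda^G)$ are isomorphic. **Corollary.** Let $G$ be a countable sofic Ornstein group, and let $(K_1,\kappa_1)$, $(K_2,\kappa_2)$ be standard Borel probability spaces. Then $(G,K_1^G,\kappa_1^G)$ is isomorphic to $(G,K_2^G,\kappa_2^G)$ if and only if $H(\kappa_1)=H(\kappa_2)$. (The values $H(\kappa_i)=+\infty$ are allowed.) -/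

import Mathlib

open MeasureTheory Filter
open scoped ENNReal Topology

noncomputable section

/-! ## Sofic groups -/

/-- For a map `σ : G → Sym(m)` (not assumed to be a homomorphism) and `F ⊆ G`, the set `V(F)` of
all `v` on which `σ` is multiplicative and free as far as `F` can see. -/
def soficGoodSet {G : Type*} [Group G] {m : ℕ} (σ : G → Equiv.Perm (Fin m)) (F : Set G) :
    Set (Fin m) :=
  {v | ∀ f₁ ∈ F, ∀ f₂ ∈ F, σ f₁ (σ f₂ v) = σ (f₁ * f₂) v ∧ (f₁ ≠ f₂ → σ f₁ v ≠ σ f₂ v)}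

/-- `σ` is an `(F, ε)`-approximation to `G`: `|V(F)| ≥ (1 - ε) m`. -/
def IsSoficApproxMap {G : Type*} [Group G] {m : ℕ} (σ : G → Equiv.Perm (Fin m)) (F : Set G)
    (ε : ℝ) : Prop :=
  (1 - ε) * (m : ℝ) ≤ ((soficGoodSet σ F).ncard : ℝ)

/-- The sequence of maps `σ i : G → Sym(m i)`, with `m i ≥ 1`, is a sofic approximation to `G`. -/
def IsSoficApproximation {G : Type*} [Group G] (m : ℕ → ℕ)
    (σ : (i : ℕ) → G → Equiv.Perm (Fin (m i))) : Prop :=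
  (∀ i, 1 ≤ m i) ∧
    ∃ (F : ℕ → Set G) (ε : ℕ → ℝ),
      (∀ i, F i ⊆ F (i + 1)) ∧ (⋃ i, F i) = Set.univ ∧ Tendsto ε atTop (𝓝 0) ∧
        ∀ i, IsSoficApproxMap (σ i) (F i) (ε i)

/-- A (countable) group is sofic if it has a sofic approximation. -/
def IsSofic (G : Type*) [Group G] : Prop :=
  ∃ (m : ℕ → ℕ) (σ : (i : ℕ) → G → Equiv.Perm (Fin (m i))), IsSoficApproximation m σ

/-! ## Isomorphism of dynamical systems -/

/-- Two `G`-systems `(G, X, μ)` and `(G, Y, ν)` are isomorphic (measurably conjugate): there are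
conull sets `X' ⊆ X`, `Y' ⊆ Y` and a bijection `φ : X' → Y'`, measurable in both directions, with
`φ_* μ = ν` and `φ (g x) = g φ(x)` for all `g ∈ G` and `x ∈ X'` (in particular `g x ∈ X'`). -/
def IsMeasurablyConjugate (G : Type*) {X Y : Type*} [Group G]
    [MeasurableSpace X] [MulAction G X] [MeasurableSpace Y] [MulAction G Y]
    (μ : Measure X) (ν : Measure Y) : Prop :=
  ∃ (X' : Set X) (Y' : Set Y),
    MeasurableSet X' ∧ MeasurableSet Y' ∧ μ X'ᶜ = 0 ∧ ν Y'ᶜ = 0 ∧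
      ∃ φ : X' ≃ᵐ Y',
        MeasurePreserving φ (μ.comap Subtype.val) (ν.comap Subtype.val) ∧
          ∀ (g : G) (x : X'), ∃ h : g • (x : X) ∈ X',
            (φ ⟨g • (x : X), h⟩ : Y) = g • (φ x : Y)

/-! ## Bernoulli shifts -/

/-- The space `K^G` of all functions `G → K`. It is a separate type because its action of `G` is
the shift, whatever actions `K` may carry. -/
def BernoulliSpace (G K : Type*) : Type _ := G → K

/-- The product Borel structure on `K^G`. -/
instance BernoulliSpace.instMeasurableSpace (G K : Type*) [MeasurableSpace K] :
    MeasurableSpace (BernoulliSpace G K) :=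
  (MeasurableSpace.pi : MeasurableSpace (G → K))

/-- The shift action `(g x)(f) = x (g⁻¹ f)`. -/
instance BernoulliSpace.instMulAction (G K : Type*) [Group G] :
    MulAction G (BernoulliSpace G K) where
  smul g x := fun f : G => x (g⁻¹ * f)
  one_smul x := by
    funext f
    change x (1⁻¹ * f) = x f
    simp
  mul_smul g h x := by
    funext f
    change x ((g * h)⁻¹ * f) = x (h⁻¹ * (g⁻¹ * f))
    simp [mul_assoc]

/-- The product measure `κ^G` on `K^G`. -/
def bernoulliMeasure (G : Type*) {K : Type*} [MeasurableSpace K] (κ : Measure K)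
    [IsProbabilityMeasure κ] : Measure (BernoulliSpace G K) :=
  (Measure.infinitePi (fun _ : G => κ) : Measure (G → K))

/-- The shift preserves the product measure, so the Bernoulli shift is a dynamical system. -/
theorem measurePreserving_bernoulli_smul (G : Type*) {K : Type*} [Group G] [MeasurableSpace K]
    (κ : Measure K) [IsProbabilityMeasure κ] (g : G) :
    MeasurePreserving (fun x : BernoulliSpace G K => g • x) (bernoulliMeasure G κ)
      (bernoulliMeasure G κ) := by
  refine ⟨measurable_pi_lambda _ fun f => measurable_pi_apply (g⁻¹ * f), ?_⟩
  have h := Measure.infinitePi_map_piCongrLeft (μ := fun _ : G => κ) (Equiv.mulLeft g)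
  have e : (fun x : G → K => fun f : G => x (g⁻¹ * f)) =
      MeasurableEquiv.piCongrLeft (fun _ : G => K) (Equiv.mulLeft g) := by
    funext x f
    have := Equiv.piCongrLeft_apply_apply (fun _ : G => K) (Equiv.mulLeft g) x (g⁻¹ * f)
    simp only [Equiv.coe_mulLeft, mul_inv_cancel_left] at this
    exact this.symm
  rw [← e] at h
  exact h

open Classical in
/-- The entropy `H(κ)` of a probability measure `κ`: if `κ` is carried by a countable set, it is
`-∑ κ({k}) log κ({k})` with `0 log 0 = 0` (a sum of non-negative terms, where points outside the
countable set contribute `0`); otherwise it is `+∞`. -/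
def baseEntropy {K : Type*} [MeasurableSpace K] (κ : Measure K) : ℝ≥0∞ :=
  if ∃ K' : Set K, K'.Countable ∧ κ K' = 1 then
    ∑' k : K, ENNReal.ofReal (Real.negMulLog (κ.real {k}))
  else ⊤

/-! ## Ornstein groups -/

/-- `G` is Ornstein: Bernoulli shifts over `G` whose bases are standard Borel probability spaces of
equal entropy are isomorphic. As every standard Borel space is Borel isomorphic to a subset
of the real line, it suffices to let the bases range over `Type`. -/
def IsOrnstein (G : Type*) [Group G] : Prop :=
  ∀ (K L : Type) [MeasurableSpace K] [StandardBorelSpace K] [MeasurableSpace L]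
    [StandardBorelSpace L] (κ : Measure K) (l : Measure L) [IsProbabilityMeasure κ]
    [IsProbabilityMeasure l],
    baseEntropy κ = baseEntropy l →
      IsMeasurablyConjugate G (bernoulliMeasure G κ) (bernoulliMeasure G l)

end

/-! If the entropies agree, the Ornstein hypothesis gives the conjugacy, once the bases are moved to
`Type` by Borel isomorphisms. For the converse, by symmetry, it suffices that a conjugacy from the
shift over `κ` to the shift over `l` forces `H(κ) ≤ H(l)`, where `H(l)` may be assumed finite. The
proof is a source-coding argument on sofic models.

Let `β` be a finite partition of `K`, and put i.i.d. `κ`-labels on the `m` points of a sofic model.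
Their `β`-names have total entropy `m · H(β)`. The conjugacy, approximated by a map with a finite
window, computes from these labels an approximate `L`-label at every point, with all but finitely
many atoms of `l` lumped together. The inverse conjugacy, likewise approximated, guesses the
`β`-name of a point from the `L`-labels near it. So the names can be encoded by writing the
`L`-labels one letter at a time and then correcting the wrong guesses. Dependence among the
`L`-labels is harmless, because the expected length depends only on the law of each single letter.
At most points this law is nearly that of the quantized `l`, so a letter costs about `H(l)`, and
corrections are rarely needed. Gibbs' inequality says that no code beats entropy, whence `H(β) ≤
H(l)` in the limit (`card_mul_partitionEntropy_le`, `partitionEntropy_le_of_isSofic`,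
`partitionEntropy_le_baseEntropy`). Finite partitions exhaust `H(κ)` by Fatou's lemma
(`exists_lt_partitionEntropy`). -/

/-! ## Finite-valued random variables -/

section FiniteValued

variable {Ω ξ α : Type*} [MeasurableSpace Ω] {P : Measure Ω}

theorem integrable_comp_of_finite [IsFiniteMeasure P] [MeasurableSpace α]
    [MeasurableSingletonClass α] [Finite α] {X : Ω → α} (hX : Measurable X) (f : α → ℝ) :
    Integrable (fun ω => f (X ω)) P :=
  (Integrable.of_finite (μ := P.map X) (f := f)).comp_measurable hX

theorem integral_comp_of_fintype [IsFiniteMeasure P] [MeasurableSpace α]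
    [MeasurableSingletonClass α] [Fintype α] {X : Ω → α} (hX : Measurable X) (f : α → ℝ) :
    ∫ ω, f (X ω) ∂P = ∑ a, P.real (X ⁻¹' {a}) * f a := by
  have h := integral_map (μ := P) hX.aemeasurable (f := f)
    (measurable_of_finite f).aestronglyMeasurable
  rw [← h, integral_fintype Integrable.of_finite]
  simp [map_measureReal_apply hX, smul_eq_mul]

/-- Gibbs' inequality, for the pair `(X, A)` and the marginal law of `X`. -/
theorem integral_neg_log_law_le [IsProbabilityMeasure P]
    [MeasurableSpace ξ] [MeasurableSingletonClass ξ] [Fintype ξ]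
    [MeasurableSpace α] [MeasurableSingletonClass α] [Fintype α]
    {X : Ω → ξ} (hX : Measurable X) {A : Ω → α} (hA : Measurable A)
    {Q : ξ → α → ℝ} (hQ : ∀ x a, 0 < Q x a) (hsum : ∑ x, ∑ a, Q x a ≤ 1) :
    ∫ ω, -Real.log (P.real (X ⁻¹' {X ω})) ∂P ≤ ∫ ω, -Real.log (Q (X ω) (A ω)) ∂P := by
  have hZ : Measurable fun ω => (X ω, A ω) := hX.prodMk hA
  have h1 := integral_comp_of_fintype (P := P) hZ
    (fun z => -Real.log (P.real (X ⁻¹' {z.1})))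
  have h2 := integral_comp_of_fintype (P := P) hZ (fun z => -Real.log (Q z.1 z.2))
  have h3 := integral_comp_of_fintype (P := P) hZ (fun _ => (1 : ℝ))
  simp only [integral_const, probReal_univ, smul_eq_mul, mul_one] at h3
  rw [h1, h2]
  set p : ξ × α → ℝ := fun z => P.real ((fun ω => (X ω, A ω)) ⁻¹' {z})
  -- This is `log t ≤ t - 1` at `t = Q / r`, with `r` the marginal probability of `x`; the bound `p
  -- ≤ r` allows a code for the pair to be compared with the entropy of `X` alone.
  have hle : ∀ z ∈ Finset.univ, p z * -Real.log (P.real (X ⁻¹' {z.1})) ≤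
      p z * -Real.log (Q z.1 z.2) + (Q z.1 z.2 - p z) := by
    rintro ⟨x, a⟩ -
    have hp : 0 ≤ p (x, a) := measureReal_nonneg
    have hpr : p (x, a) ≤ P.real (X ⁻¹' {x}) :=
      measureReal_mono fun ω hω => by
        simp only [Set.mem_preimage, Set.mem_singleton_iff, Prod.mk.injEq] at hω ⊢
        exact hω.1
    rcases hp.eq_or_lt with h0 | h0
    · rw [← h0]; simpa using (hQ x a).le
    · have hr := h0.trans_le hpr
      have hlog := Real.log_le_sub_one_of_pos (div_pos (hQ x a) hr)
      rw [Real.log_div (hQ x a).ne' hr.ne'] at hlog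
      have h4 : p (x, a) * (Q x a / P.real (X ⁻¹' {x})) ≤ Q x a := by
        rw [mul_div_assoc', div_le_iff₀ hr, mul_comm]
        exact mul_le_mul_of_nonneg_left hpr (hQ x a).le
      have := mul_le_mul_of_nonneg_left hlog hp
      dsimp only
      linarith
  refine (Finset.sum_le_sum hle).trans ?_
  have hQ1 : ∑ z : ξ × α, Q z.1 z.2 ≤ 1 := by rwa [Fintype.sum_prod_type]
  rw [Finset.sum_add_distrib, Finset.sum_sub_distrib, ← h3]
  linarith

end FiniteValued

/-! ## Entropy of an i.i.d. family and codes -/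

theorem infinitePi_real_preimage_singleton {V K B : Type*} [MeasurableSpace K]
    [Fintype V] (κ : Measure K) [IsProbabilityMeasure κ]
    {β : K → B} (x : V → B) :
    (Measure.infinitePi fun _ : V => κ).real ((fun ω v => β (ω v)) ⁻¹' {x}) =
      ∏ v, κ.real (β ⁻¹' {x v}) := by
  have : (fun (ω : V → K) v => β (ω v)) ⁻¹' {x} =
      Set.pi Set.univ fun v => β ⁻¹' {x v} := by
    ext ω; simp [funext_iff]
  rw [this, measureReal_def, Measure.infinitePi_eq_pi, Measure.pi_pi, ENNReal.toReal_prod]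
  rfl

/-- Kraft's inequality for a two-stage code: once `a` is fixed, every guess `d v a` is fixed too, so
the sum over `x` factors over the points. -/
theorem sum_prod_code_le_one {V α B : Type*} [Fintype B] [Fintype V] [DecidableEq V]
    [Fintype α] {W : α → ℝ} (hW : ∀ a, 0 < W a)
    (hW1 : ∑ a, W a ≤ 1) {w : B → B → ℝ} (hw : ∀ x b, 0 < w x b)
    (hw1 : ∀ b, ∑ x, w x b ≤ 1) (d : V → (V → α) → B) :
    ∑ x : V → B, ∑ a : V → α, ∏ v, (W (a v) * w (x v) (d v a)) ≤ 1 := by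
  rw [Finset.sum_comm]
  calc ∑ a : V → α, ∑ x : V → B, ∏ v, (W (a v) * w (x v) (d v a))
      = ∑ a : V → α, (∏ v, W (a v)) * ∏ v, ∑ x, w x (d v a) := by
        refine Finset.sum_congr rfl fun a _ => ?_
        simp_rw [Finset.prod_mul_distrib, ← Finset.mul_sum]
        rw [Finset.prod_univ_sum, Fintype.piFinset_univ]
    _ ≤ ∑ a : V → α, ∏ v, W (a v) := by
        refine Finset.sum_le_sum fun a _ => mul_le_of_le_one_right
          (Finset.prod_nonneg fun v _ => (hW _).le)
          (Finset.prod_le_one (fun v _ => Finset.sum_nonneg fun x _ => (hw _ _).le)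
            fun v _ => hw1 _)
    _ = ∏ _v : V, ∑ a, W a := by rw [Finset.prod_univ_sum, Fintype.piFinset_univ]
    _ ≤ 1 := Finset.prod_le_one (fun v _ => Finset.sum_nonneg fun a _ => (hW a).le) fun v _ => hW1

section Code

variable {V K α B : Type*} [MeasurableSpace K] [MeasurableSpace α] [MeasurableSpace B]
  [MeasurableSingletonClass B] [Fintype B]

/-- The Shannon entropy of the law of a random variable with finitely many values. -/
noncomputable def partitionEntropy (κ : Measure K) (β : K → B) : ℝ :=
  ∑ b, Real.negMulLog (κ.real (β ⁻¹' {b}))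

theorem map_eval_infinitePi_integral [Fintype V] (κ : Measure K) [IsProbabilityMeasure κ]
    {β : K → B} (hβ : Measurable β) (v : V) (f : B → ℝ) :
    ∫ ω, f (β (ω v)) ∂(Measure.infinitePi fun _ : V => κ) = ∫ k, f (β k) ∂κ := by
  have h := integral_map (μ := Measure.infinitePi fun _ : V => κ) (φ := fun ω => ω v)
    (measurable_pi_apply v).aemeasurable (f := fun k => f (β k))
    ((measurable_of_finite f).comp hβ).aestronglyMeasurable
  rw [← h, Measure.infinitePi_map_eval]

theorem integral_neg_log_law_infinitePi [Fintype V] (κ : Measure K) [IsProbabilityMeasure κ]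
    {β : K → B} (hβ : Measurable β) :
    ∫ ω, -Real.log ((Measure.infinitePi fun _ : V => κ).real
        ((fun ω v => β (ω v)) ⁻¹' {fun v => β (ω v)})) ∂(Measure.infinitePi fun _ : V => κ) =
      Fintype.card V * partitionEntropy κ β := by
  -- Letters of probability zero are discarded, since the logarithm of a product splits only when
  -- all factors are nonzero.
  have hκ : ∀ᵐ k ∂κ, κ.real (β ⁻¹' {β k}) ≠ 0 := by
    have h : ∀ b, ∀ᵐ k ∂κ, β k = b → κ.real (β ⁻¹' {β k}) ≠ 0 := by
      intro b
      by_cases hb : κ (β ⁻¹' {b}) = 0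
      · filter_upwards [measure_eq_zero_iff_ae_notMem.1 hb] with k hk hkb
        exact absurd hkb hk
      · refine ae_of_all _ fun k hk => ?_
        rw [hk, measureReal_def]
        exact (ENNReal.toReal_pos hb (measure_ne_top _ _)).ne'
    filter_upwards [ae_all_iff.2 h] with k hk using hk _ rfl
  have hae : ∀ᵐ ω ∂(Measure.infinitePi fun _ : V => κ), ∀ v, κ.real (β ⁻¹' {β (ω v)}) ≠ 0 := by
    refine ae_all_iff.2 fun v => ?_
    exact (measurePreserving_eval_infinitePi (fun _ : V => κ) v).quasiMeasurePreserving.ae hκ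
  have hcongr := integral_congr_ae (μ := Measure.infinitePi fun _ : V => κ)
    (f := fun ω => -Real.log ((Measure.infinitePi fun _ : V => κ).real
        ((fun ω v => β (ω v)) ⁻¹' {fun v => β (ω v)})))
    (g := fun ω => ∑ v, -Real.log (κ.real (β ⁻¹' {β (ω v)})))
    (by
      filter_upwards [hae] with ω hω
      rw [infinitePi_real_preimage_singleton, Real.log_prod fun v _ => hω v,
        Finset.sum_neg_distrib])
  rw [hcongr, integral_finsetSum]
  · have h : ∀ v : V, ∫ ω, -Real.log (κ.real (β ⁻¹' {β (ω v)}))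
        ∂(Measure.infinitePi fun _ : V => κ) = partitionEntropy κ β := by
      intro v
      rw [map_eval_infinitePi_integral κ hβ v fun b => -Real.log (κ.real (β ⁻¹' {b})),
        integral_comp_of_fintype hβ fun b => -Real.log (κ.real (β ⁻¹' {b}))]
      exact Finset.sum_congr rfl fun b _ => by rw [Real.negMulLog]; ring
    simp [h]
  · intro v _
    exact integrable_comp_of_finite (hβ.comp (measurable_pi_apply v))
      fun b => -Real.log (κ.real (β ⁻¹' {b}))

/-- The entropy of an i.i.d. family is at most the expected length of a code that first describes
`A` letter by letter with the code lengths `-log W`, and then corrects the guess `d v A`. -/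
theorem card_mul_partitionEntropy_le [Fintype V] [MeasurableSingletonClass α] [Fintype α]
    (κ : Measure K) [IsProbabilityMeasure κ] {β : K → B} (hβ : Measurable β)
    {W : α → ℝ} (hW : ∀ a, 0 < W a)
    (hW1 : ∑ a, W a ≤ 1) {w : B → B → ℝ} (hw : ∀ x b, 0 < w x b) (hw1 : ∀ b, ∑ x, w x b ≤ 1)
    {A : (V → K) → V → α} (hA : Measurable A) (d : V → (V → α) → B) :
    Fintype.card V * partitionEntropy κ β ≤
      ∑ v, ∫ ω, (-Real.log (W (A ω v)) - Real.log (w (β (ω v)) (d v (A ω))))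
        ∂(Measure.infinitePi fun _ : V => κ) := by
  classical
  have hX : Measurable fun (ω : V → K) v => β (ω v) :=
    measurable_pi_lambda _ fun v => hβ.comp (measurable_pi_apply v)
  rw [← integral_neg_log_law_infinitePi κ hβ, ← integral_finsetSum]
  · have h := integral_neg_log_law_le (P := Measure.infinitePi fun _ : V => κ) hX hA
      (Q := fun x a => ∏ v, (W (a v) * w (x v) (d v a)))
      (fun x a => Finset.prod_pos fun v _ => mul_pos (hW _) (hw _ _))
      (sum_prod_code_le_one hW hW1 hw hw1 d)
    refine h.trans_eq (integral_congr_ae (ae_of_all _ fun ω => ?_))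
    dsimp only
    rw [Real.log_prod fun v _ => (mul_pos (hW _) (hw _ _)).ne', ← Finset.sum_neg_distrib]
    refine Finset.sum_congr rfl fun v _ => ?_
    rw [Real.log_mul (hW _).ne' (hw _ _).ne']
    ring
  · intro v _
    exact integrable_comp_of_finite (hX.prodMk hA)
      fun z => -Real.log (W (z.2 v)) - Real.log (w (z.1 v) (d v z.2))

end Code

/-! ## The sofic bound for codes with finite windows -/

section Sofic

variable {G K α B : Type*} [Group G] [MeasurableSpace K]

theorem eq_of_mem_soficGoodSet {m : ℕ} {σ : G → Equiv.Perm (Fin m)} {F : Set G} (h1 : 1 ∈ F)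
    {v : Fin m} (hv : v ∈ soficGoodSet σ F) : σ 1 v = v :=
  (σ 1).injective (by simpa using (hv 1 h1 1 h1).1)

theorem injective_of_mem_soficGoodSet {m : ℕ} {σ : G → Equiv.Perm (Fin m)} {F : Set G}
    {T : Finset G} (hT : ∀ t ∈ T, t⁻¹ ∈ F) {v : Fin m} (hv : v ∈ soficGoodSet σ F) :
    Function.Injective fun t : T => σ (t : G)⁻¹ v := by
  intro s t hst
  by_contra hne
  refine (hv _ (hT s s.2) _ (hT t t.2)).2 (fun h => hne (Subtype.ext (inv_injective h))) hst

/-- At a good point the window seen through `σ` has the law of the window of the Bernoulli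
shift. -/
theorem integral_window_eq_of_mem_soficGoodSet {m : ℕ} {σ : G → Equiv.Perm (Fin m)} {F : Set G}
    {T : Finset G} (hT : ∀ t ∈ T, t⁻¹ ∈ F) {v : Fin m} (hv : v ∈ soficGoodSet σ F)
    (κ : Measure K) [IsProbabilityMeasure κ] {f : (T → K) → ℝ} (hf : Measurable f) :
    ∫ ω, f (fun t => ω (σ (t : G)⁻¹ v)) ∂(Measure.infinitePi fun _ : Fin m => κ) =
      ∫ y, f (fun t => y t) ∂(Measure.infinitePi fun _ : G => κ) := by
  have h1 := integral_map (μ := Measure.infinitePi fun _ : Fin m => κ)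
    (φ := fun ω (t : T) => ω (σ (t : G)⁻¹ v))
    (measurable_pi_lambda _ fun t => measurable_pi_apply _).aemeasurable
    hf.aestronglyMeasurable
  have h2 := integral_map (μ := Measure.infinitePi fun _ : G => κ)
    (φ := fun y (t : T) => y (t : G))
    (measurable_pi_lambda _ fun t => measurable_pi_apply _).aemeasurable
    hf.aestronglyMeasurable
  rw [← h1, ← h2, Measure.map_infinitePi_infinitePi_of_inj
      (P := fun _ : Fin m => κ) (injective_of_mem_soficGoodSet hT hv),
    Measure.map_infinitePi_infinitePi_of_inj (P := fun _ : G => κ) Subtype.val_injective]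

theorem IsSoficApproximation.eventually_finset_inv_mem {F : ℕ → Set G}
    (hmono : ∀ i, F i ⊆ F (i + 1)) (hcover : ⋃ i, F i = Set.univ) (T : Finset G) :
    ∀ᶠ i in atTop, ∀ t ∈ T, t⁻¹ ∈ F i := by
  refine (Finset.eventually_all T).2 fun t _ => ?_
  obtain ⟨j, hj⟩ := Set.mem_iUnion.1 (hcover ▸ Set.mem_univ t⁻¹ : t⁻¹ ∈ ⋃ i, F i)
  filter_upwards [eventually_ge_atTop j] with i hi
  exact monotone_nat_of_le_succ hmono hi hj

variable [MeasurableSpace α] [MeasurableSingletonClass α] [Fintype α]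
  [MeasurableSpace B] [MeasurableSingletonClass B] [Fintype B]

/-- The code is run on the sofic models. A good point contributes exactly the integral on the right,
because its window has the correct law; a bad point contributes at most a constant, and the
proportion of bad points tends to zero. -/
theorem partitionEntropy_le_of_isSofic (hG : IsSofic G) (κ : Measure K) [IsProbabilityMeasure κ]
    {β : K → B} (hβ : Measurable β) {W : α → ℝ} (hW : ∀ a, 0 < W a) (hW1 : ∑ a, W a ≤ 1)
    {w : B → B → ℝ} (hw : ∀ x b, 0 < w x b) (hw1 : ∀ b, ∑ x, w x b ≤ 1)
    {E D : Finset G} {a : (E → K) → α} (ha : Measurable a) (c : (D → α) → B) :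
    partitionEntropy κ β ≤ ∫ y, (-Real.log (W (a fun h => y h)) -
      Real.log (w (β (y 1)) (c fun f => a fun h => y (f * h))))
        ∂(Measure.infinitePi fun _ : G => κ) := by
  classical
  obtain ⟨m, σ, hm, F, ε, hmono, hcover, hε, happ⟩ := hG
  set I := ∫ y, (-Real.log (W (a fun h => y h)) -
      Real.log (w (β (y 1)) (c fun f => a fun h => y (f * h))))
        ∂(Measure.infinitePi fun _ : G => κ) with hI
  obtain ⟨M, hM⟩ : ∃ M, ∀ z : α × B × B, -Real.log (W z.1) - Real.log (w z.2.1 z.2.2) ≤ M := by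
    obtain ⟨M, hM⟩ := (Set.finite_range
      fun z : α × B × B => -Real.log (W z.1) - Real.log (w z.2.1 z.2.2)).bddAbove
    exact ⟨M, fun z => hM ⟨z, rfl⟩⟩
  -- All coordinates that the integrand reads: the origin, the window of `a`, the positions used by
  -- `c`, and the windows of `a` around these.
  let T : Finset G := insert 1 (E ∪ D ∪ Finset.image₂ (· * ·) D E)
  have hT1 : 1 ∈ T := Finset.mem_insert_self _ _
  have hTE : ∀ h : E, (h : G) ∈ T := fun h => by simp [T]
  have hTD : ∀ f : D, (f : G) ∈ T := fun h => by simp [T]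
  have hTDE : ∀ (f : D) (h : E), (f : G) * h ∈ T := fun f h =>
    Finset.mem_insert_of_mem (Finset.mem_union_right _
      (Finset.mem_image₂_of_mem f.2 h.2))
  let f : (T → K) → ℝ := fun z => -Real.log (W (a fun h => z ⟨h, hTE h⟩)) -
    Real.log (w (β (z ⟨1, hT1⟩)) (c fun f => a fun h => z ⟨f * h, hTDE f h⟩))
  have hf : Measurable f := by
    have hg : Measurable fun z : T → K => ((a fun h => z ⟨h, hTE h⟩, β (z ⟨1, hT1⟩),
        fun f : D => a fun h => z ⟨f * h, hTDE f h⟩) : α × B × (D → α)) :=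
      (ha.comp (measurable_pi_lambda _ fun h => measurable_pi_apply _)).prodMk
        ((hβ.comp (measurable_pi_apply _)).prodMk (measurable_pi_lambda _ fun f =>
          ha.comp (measurable_pi_lambda _ fun h => measurable_pi_apply _)))
    exact (measurable_of_finite fun u : α × B × (D → α) =>
      -Real.log (W u.1) - Real.log (w u.2.1 (c u.2.2))).comp hg
  have key : ∀ᶠ i in atTop, partitionEntropy κ β ≤ I + ε i * |M - I| := by
    filter_upwards [IsSoficApproximation.eventually_finset_inv_mem hmono hcover T] with i hTF
    set P := Measure.infinitePi fun _ : Fin (m i) => κ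
    -- The coordinate `y h` is modelled at `v` by the label at `σ i h⁻¹ v`. With the inverse, moving
    -- by `f` and then by `h` leads to `(f * h)⁻¹`, as the shift requires.
    let A : (Fin (m i) → K) → Fin (m i) → α := fun ω v => a fun h : E => ω (σ i (h : G)⁻¹ v)
    have hA : Measurable A := measurable_pi_lambda _ fun v =>
      ha.comp (measurable_pi_lambda _ fun h => measurable_pi_apply _)
    let d : Fin (m i) → (Fin (m i) → α) → B := fun v u => c fun f : D => u (σ i (f : G)⁻¹ v)
    have hmain := card_mul_partitionEntropy_le κ hβ hW hW1 hw hw1 hA d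
    set t : Fin (m i) → ℝ := fun v => ∫ ω,
      (-Real.log (W (A ω v)) - Real.log (w (β (ω v)) (d v (A ω)))) ∂P with ht
    have hgood : ∀ v ∈ soficGoodSet (σ i) (F i), t v = I := by
      intro v hv
      have h1F : (1 : G) ∈ F i := by simpa using hTF 1 hT1
      have h := integral_window_eq_of_mem_soficGoodSet hTF hv κ hf
      refine Eq.trans (integral_congr_ae (ae_of_all _ fun ω => ?_)) h
      have e1 : σ i (1 : G)⁻¹ v = v := by rw [inv_one]; exact eq_of_mem_soficGoodSet h1F hv
      have e2 : ∀ (f : D) (h : E), σ i (h : G)⁻¹ (σ i (f : G)⁻¹ v) =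
          σ i ((f : G) * h)⁻¹ v := fun f h => by
        rw [(hv _ (hTF _ (hTE h)) _ (hTF _ (hTD f))).1, mul_inv_rev]
      simp only [A, d, f, e1, e2]
    have hbad : ∀ v, t v ≤ M := by
      intro v
      have hint := integrable_comp_of_finite (P := P)
        (X := fun ω : Fin (m i) → K => ((A ω v, β (ω v), A ω) : α × B × (Fin (m i) → α)))
        (((measurable_pi_apply v).comp hA).prodMk
          ((hβ.comp (measurable_pi_apply v)).prodMk hA))
        (fun u => -Real.log (W u.1) - Real.log (w u.2.1 (d v u.2.2)))
      have := integral_mono hint (integrable_const M) fun ω => hM (A ω v, β (ω v), d v (A ω))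
      simpa using this
    set g : Finset (Fin (m i)) := Finset.univ.filter (· ∈ soficGoodSet (σ i) (F i)) with hg
    have hgcard : (soficGoodSet (σ i) (F i)).ncard = g.card := by
      rw [← Set.ncard_coe_finset]; congr 1; ext; simp [hg]
    have hgm : (g.card : ℝ) ≤ m i := by
      have := Finset.card_le_univ g
      rw [Fintype.card_fin] at this
      exact_mod_cast this
    have hsum : ∑ v, t v ≤ m i * I + (m i - g.card) * (M - I) := by
      have : ∀ v ∈ Finset.univ, t v ≤ M - if v ∈ g then M - I else 0 := by
        intro v _
        split_ifs with h
        · rw [hgood v (by simpa [hg] using h)]; linarith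
        · simpa using hbad v
      refine (Finset.sum_le_sum this).trans_eq ?_
      rw [Finset.sum_sub_distrib, Finset.sum_ite_mem, Finset.univ_inter]
      simp
      ring
    have happ' : (1 - ε i) * (m i : ℝ) ≤ g.card := hgcard ▸ happ i
    have hmpos : (0 : ℝ) < m i := by exact_mod_cast hm i
    -- The absolute value makes the sign of `M - I` irrelevant.
    have h2 : (m i - g.card : ℝ) * (M - I) ≤ ε i * m i * |M - I| := by
      calc (m i - g.card : ℝ) * (M - I) ≤ (m i - g.card : ℝ) * |M - I| :=
            mul_le_mul_of_nonneg_left (le_abs_self _) (by linarith)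
        _ ≤ _ := mul_le_mul_of_nonneg_right (by linarith) (abs_nonneg _)
    rw [Fintype.card_fin] at hmain
    refine le_of_mul_le_mul_left ?_ hmpos
    calc (m i : ℝ) * partitionEntropy κ β ≤ ∑ v, t v := hmain
      _ ≤ _ := by linarith
  have hlim : Tendsto (fun i => I + ε i * |M - I|) atTop (𝓝 (I + 0 * |M - I|)) :=
    tendsto_const_nhds.add (hε.mul_const _)
  rw [zero_mul, add_zero] at hlim
  exact ge_of_tendsto hlim key

end Sofic

/-! ## Approximation by functions of finitely many coordinates -/

/-- A finite-valued measurable function on a product space agrees, off a set of small measure, with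
a function of finitely many coordinates. -/
theorem exists_window_approx {ι K α : Type*} [MeasurableSpace K] [MeasurableSpace α]
    [MeasurableSingletonClass α] [Finite α] (μ : Measure (ι → K)) [IsProbabilityMeasure μ]
    {f : (ι → K) → α} (hf : Measurable f) {η : ℝ} (hη : 0 < η) :
    ∃ (E : Finset ι) (a : (E → K) → α), Measurable a ∧
      μ.real {y | f y ≠ a fun i => y i} ≤ η := by
  classical
  cases nonempty_fintype α
  obtain ⟨y₀⟩ : Nonempty (ι → K) := nonempty_of_isProbabilityMeasure μ
  -- Cylinders form an algebra generating the product structure, so each level set of `f` is close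
  -- in measure to a cylinder.
  have hdense := Measure.MeasureDense.of_generateFrom_isSetAlgebra_finite (μ := μ)
    isSetAlgebra_measurableCylinders generateFrom_measurableCylinders.symm
  have hδ : 0 < η / (Fintype.card α + 1) := by positivity
  choose C hC hCμ using fun b : α => hdense.approx (f ⁻¹' {b})
    (hf (measurableSet_singleton b)) (measure_ne_top _ _) _ hδ
  choose s S hS hCS using fun b => (mem_measurableCylinders (C b)).1 (hC b)
  let E : Finset ι := Finset.univ.biUnion s
  have hsE : ∀ b (i : s b), (i : ι) ∈ E := fun b i =>
    Finset.mem_biUnion.2 ⟨b, Finset.mem_univ _, i.2⟩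
  let p : (E → K) → α → Prop := fun z b => (fun i : s b => z ⟨i, hsE b i⟩) ∈ S b
  have hp : Measurable p := measurable_pi_lambda _ fun b => by
    have : Measurable fun (z : E → K) (i : s b) => z ⟨i, hsE b i⟩ :=
      measurable_pi_lambda _ fun i => measurable_pi_apply _
    exact measurableSet_setOfPred.1 (this (hS b))
  -- Off the exceptional set exactly one cylinder contains `y`, and the choice is forced; elsewhere
  -- any value will do.
  let g : (α → Prop) → α := fun q => if h : ∃ b, q b then h.choose else f y₀
  refine ⟨E, g ∘ p, (measurable_of_finite g).comp hp, ?_⟩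
  have hsub : {y | f y ≠ (g ∘ p) fun i => y i} ⊆ ⋃ b, symmDiff (f ⁻¹' {b}) (C b) := by
    intro y hy
    by_contra hcon
    simp only [Set.mem_iUnion, not_exists] at hcon
    have hiff : ∀ b, p (fun i => y i) b ↔ f y = b := by
      intro b
      have h1 : y ∈ C b ↔ p (fun i => y i) b := by rw [hCS b]; rfl
      have h2 := hcon b
      simp only [Set.mem_symmDiff, Set.mem_preimage, Set.mem_singleton_iff] at h2
      tauto
    apply hy
    have hex : ∃ b, p (fun i => y i) b := ⟨f y, (hiff _).2 rfl⟩
    change f y = g (p fun i => y i)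
    simp only [g, dif_pos hex]
    exact (hiff _).1 hex.choose_spec
  calc μ.real {y | f y ≠ (g ∘ p) fun i => y i}
      ≤ μ.real (⋃ b, symmDiff (f ⁻¹' {b}) (C b)) := measureReal_mono hsub
    _ ≤ ∑ b, μ.real (symmDiff (f ⁻¹' {b}) (C b)) := measureReal_iUnion_fintype_le _
    _ ≤ ∑ _b : α, η / (Fintype.card α + 1) := by
        refine Finset.sum_le_sum fun b _ => ?_
        exact ENNReal.toReal_le_of_le_ofReal hδ.le (hCμ b).le
    _ ≤ η := by
        rw [Finset.sum_const, nsmul_eq_mul, Finset.card_univ, mul_div_assoc',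
          div_le_iff₀ (by positivity)]
        nlinarith

/-! ## Finite partitions of large entropy -/

/-- The information content `-log x` of an event of probability `x`. -/
noncomputable def informationContent (x : ℝ≥0∞) : ℝ≥0∞ := (-ENNReal.log x).toENNReal

theorem continuous_informationContent : Continuous informationContent :=
  EReal.continuous_toENNReal.comp (continuous_neg.comp ENNReal.continuous_log)

theorem informationContent_zero : informationContent 0 = ⊤ := by
  simp [informationContent]

theorem informationContent_of_ne_zero {x : ℝ≥0∞} (h0 : x ≠ 0) (h1 : x ≠ ⊤) :
    informationContent x = ENNReal.ofReal (-Real.log x.toReal) := by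
  rw [informationContent, ENNReal.log_pos_real h0 h1, ← EReal.coe_neg, EReal.real_coe_toENNReal]

theorem informationContent_mul {x : ℝ≥0∞} (h1 : x ≠ ⊤) :
    informationContent x * x = ENNReal.ofReal (Real.negMulLog x.toReal) := by
  rcases eq_or_ne x 0 with rfl | h0
  · simp
  · rw [informationContent_of_ne_zero h0 h1]
    nth_rw 2 [← ENNReal.ofReal_toReal h1]
    rw [← ENNReal.ofReal_mul' ENNReal.toReal_nonneg, Real.negMulLog]
    congr 1
    ring

section

variable {K B : Type*} [MeasurableSpace K]

theorem lintegral_informationContent_comp [MeasurableSpace B] [MeasurableSingletonClass B]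
    [Fintype B] (κ : Measure K) [IsProbabilityMeasure κ] {β : K → B} (hβ : Measurable β) :
    ∫⁻ k, informationContent (κ (β ⁻¹' {β k})) ∂κ = ENNReal.ofReal (partitionEntropy κ β) := by
  have h := lintegral_map (μ := κ) (f := fun b => informationContent (κ (β ⁻¹' {b})))
    (measurable_of_finite _) hβ
  rw [← h, lintegral_fintype, partitionEntropy, ENNReal.ofReal_sum_of_nonneg
    fun b _ => Real.negMulLog_nonneg measureReal_nonneg measureReal_le_one]
  refine Finset.sum_congr rfl fun b _ => ?_
  rw [Measure.map_apply hβ (measurableSet_singleton b),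
    informationContent_mul (measure_ne_top _ _), measureReal_def]

/-- On a countable carrier the integral is the entropy sum. Without such a carrier the points of
mass zero have positive measure and infinite information content, so the integral is `⊤`. -/
theorem baseEntropy_le_lintegral_informationContent [MeasurableSingletonClass K] (κ : Measure K)
    [IsProbabilityMeasure κ] :
    baseEntropy κ ≤ ∫⁻ k, informationContent (κ {k}) ∂κ := by
  rw [baseEntropy]
  split_ifs with h
  · obtain ⟨K', hK', h1⟩ := h
    have hzero : Function.support (fun k => ENNReal.ofReal (Real.negMulLog (κ.real {k}))) ⊆ K' := by
      intro k hk
      by_contra hkK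
      have h0 : κ {k} = 0 := measure_mono_null (Set.singleton_subset_iff.2 hkK)
        ((prob_compl_eq_zero_iff hK'.measurableSet).2 h1)
      exact hk (by simp [measureReal_def, h0])
    rw [← tsum_subtype_eq_of_support_subset hzero]
    refine le_trans (le_of_eq ?_) (setLIntegral_le_lintegral K' _)
    rw [lintegral_countable _ hK']
    exact tsum_congr fun k => by
      rw [informationContent_mul (measure_ne_top _ _), measureReal_def]
  · have hC : {k | 0 < κ {k}}.Countable := by
      have := Measure.countable_meas_pos_of_disjoint_iUnion (μ := κ) (As := fun k : K => {k})
        (fun k => measurableSet_singleton k) (fun i j hij => by simpa using hij)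
      exact this
    have hpos : κ {k | 0 < κ {k}}ᶜ ≠ 0 := fun h0 =>
      h ⟨_, hC, (prob_compl_eq_zero_iff hC.measurableSet).1 h0⟩
    refine le_trans (le_of_eq ?_) (setLIntegral_le_lintegral {k | 0 < κ {k}}ᶜ _)
    rw [setLIntegral_congr_fun (g := fun _ => ⊤) hC.measurableSet.compl]
    · simp [ENNReal.top_mul hpos]
    · intro k hk
      have : κ {k} = 0 := by simpa using hk
      simp [this, informationContent_zero]

/-- The base entropy is approached by the entropies of finite partitions. -/
theorem exists_lt_partitionEntropy [StandardBorelSpace K] (κ : Measure K) [IsProbabilityMeasure κ]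
    {r : ℝ≥0∞} (hr : r < baseEntropy κ) :
    ∃ (n : ℕ) (β : K → Fin n → Bool), Measurable β ∧
      r < ENNReal.ofReal (partitionEntropy κ β) := by
  -- The partitions record the first `n` bits of an injection into Cantor space. Their cells shrink
  -- to points, so information contents converge pointwise and Fatou's lemma applies.
  obtain ⟨f, hf, hinj⟩ := MeasurableSpace.measurable_injection_nat_bool_of_countablySeparated K
  let β : (n : ℕ) → K → Fin n → Bool := fun n k i => f k i
  have hβ : ∀ n, Measurable (β n) := fun n =>
    measurable_pi_lambda _ fun i => (measurable_pi_apply _).comp hf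
  have hlim : ∀ k, Tendsto (fun n => κ (β n ⁻¹' {β n k})) atTop (𝓝 (κ {k})) := by
    intro k
    have hanti : Antitone fun n => β n ⁻¹' {β n k} := by
      intro n m hnm x hx
      simp only [Set.mem_preimage, Set.mem_singleton_iff] at hx ⊢
      exact funext fun i => congrFun hx (Fin.castLE hnm i)
    have hI : ⋂ n, β n ⁻¹' {β n k} = {k} := by
      ext x
      simp only [Set.mem_iInter, Set.mem_preimage, Set.mem_singleton_iff]
      refine ⟨fun h => hinj (funext fun i => ?_), fun h n => by rw [h]⟩
      exact congrFun (h (i + 1)) ⟨i, Nat.lt_succ_self i⟩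
    rw [← hI]
    exact tendsto_measure_iInter_atTop
      (fun n => (hβ n (measurableSet_singleton _)).nullMeasurableSet) hanti
      ⟨0, measure_ne_top _ _⟩
  have hfatou := lintegral_liminf_le (μ := κ) (u := atTop)
    (f := fun n k => informationContent (κ (β n ⁻¹' {β n k})))
    fun n => (measurable_of_finite fun b => informationContent (κ (β n ⁻¹' {b}))).comp (hβ n)
  have hlim' : ∀ k, liminf (fun n => informationContent (κ (β n ⁻¹' {β n k}))) atTop =
      informationContent (κ {k}) := fun k =>
    ((continuous_informationContent.tendsto _).comp (hlim k)).liminf_eq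
  simp_rw [hlim', lintegral_informationContent_comp κ (hβ _)] at hfatou
  have hlt := (hr.trans_le (baseEntropy_le_lintegral_informationContent κ)).trans_le hfatou
  obtain ⟨n, hn⟩ := (eventually_lt_of_lt_liminf hlt).exists
  exact ⟨n, β n, hβ n, hn⟩

end

/-! ## The sofic bound for measurable codes -/

section MeasurableCodes

variable {G K α B : Type*} [Group G] [MeasurableSpace K]
  [MeasurableSpace α] [MeasurableSingletonClass α] [Fintype α]
  [MeasurableSpace B] [MeasurableSingletonClass B] [Fintype B]

theorem measurePreserving_mul_left_infinitePi {G K : Type*} [Group G] [MeasurableSpace K]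
    (κ : Measure K) [IsProbabilityMeasure κ] (f : G) :
    MeasurePreserving (fun (y : G → K) h => y (f * h)) (Measure.infinitePi fun _ : G => κ)
      (Measure.infinitePi fun _ : G => κ) :=
  ⟨measurable_pi_lambda _ fun _ => measurable_pi_apply _,
    Measure.map_infinitePi_infinitePi_of_inj (P := fun _ : G => κ) (mul_right_injective f)⟩

/-- Replacing `a` by a finite-window map alters the integrand only where the two differ at `y` or at
one of its translates by `D`. As the integrand takes finitely many values, the integral changes by
an arbitrarily small amount. -/
theorem partitionEntropy_le_of_isSofic_of_measurable (hG : IsSofic G) (κ : Measure K)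
    [IsProbabilityMeasure κ] {β : K → B} (hβ : Measurable β) {W : α → ℝ} (hW : ∀ a, 0 < W a)
    (hW1 : ∑ a, W a ≤ 1) {w : B → B → ℝ} (hw : ∀ x b, 0 < w x b) (hw1 : ∀ b, ∑ x, w x b ≤ 1)
    {D : Finset G} {a : (G → K) → α} (ha : Measurable a) (c : (D → α) → B) :
    partitionEntropy κ β ≤ ∫ y, (-Real.log (W (a y)) -
      Real.log (w (β (y 1)) (c fun f => a fun h => y (f * h))))
        ∂(Measure.infinitePi fun _ : G => κ) := by
  classical
  set μ := Measure.infinitePi fun _ : G => κ with hμ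
  have hshift := measurePreserving_mul_left_infinitePi (G := G) κ
  let J : α × B × (D → α) → ℝ := fun u => -Real.log (W u.1) - Real.log (w u.2.1 (c u.2.2))
  have hJm : ∀ {b : (G → K) → α}, Measurable b → Measurable fun y : G → K =>
      ((b y, β (y 1), fun f : D => b fun h => y (f * h)) : α × B × (D → α)) := fun hb =>
    hb.prodMk ((hβ.comp (measurable_pi_apply _)).prodMk
      (measurable_pi_lambda _ fun f => hb.comp (hshift f).measurable))
  obtain ⟨M, hM⟩ : ∃ M, ∀ u u', J u ≤ J u' + M := by
    obtain ⟨M, hM⟩ := (Set.finite_range fun z : (α × B × (D → α)) × (α × B × (D → α)) =>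
      J z.1 - J z.2).bddAbove
    refine ⟨M, fun u u' => ?_⟩
    have : J u - J u' ≤ M := hM ⟨(u, u'), rfl⟩
    linarith
  have hM0 : 0 ≤ M := by
    obtain ⟨y⟩ : Nonempty (G → K) := nonempty_of_isProbabilityMeasure μ
    have := hM (a y, β (y 1), fun _ => a y) (a y, β (y 1), fun _ => a y)
    linarith
  have key : ∀ η > 0, partitionEntropy κ β ≤
      ∫ y, J (a y, β (y 1), fun f : D => a fun h => y (f * h)) ∂μ + η * (M * (D.card + 1)) := by
    intro η hη
    obtain ⟨E, b, hb, hbη⟩ := exists_window_approx μ ha hη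
    have hb' : Measurable fun y : G → K => b fun h => y h :=
      hb.comp (measurable_pi_lambda _ fun _ => measurable_pi_apply _)
    have hmain := partitionEntropy_le_of_isSofic hG κ hβ hW hW1 hw hw1 hb c
    set N : Set (G → K) := {y | a y ≠ b fun h => y h} with hN
    have hNm : MeasurableSet N := (measurableSet_eq_fun ha hb').compl
    set N' : Set (G → K) := N ∪ ⋃ f : D, (fun (y : G → K) h => y ((f : G) * h)) ⁻¹' N
    have hN'm : MeasurableSet N' :=
      hNm.union (MeasurableSet.iUnion fun f => (hshift f).measurable hNm)
    have hN' : μ.real N' ≤ η * (D.card + 1) := by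
      have h1 : ∀ f : D, μ.real ((fun (y : G → K) h => y ((f : G) * h)) ⁻¹' N) = μ.real N :=
        fun f => (hshift f).measureReal_preimage hNm.nullMeasurableSet
      calc μ.real N' ≤ μ.real N + ∑ f : D, μ.real ((fun (y : G → K) h => y ((f : G) * h)) ⁻¹' N) :=
            (measureReal_union_le _ _).trans
              (add_le_add_right (measureReal_iUnion_fintype_le _) _)
        _ = μ.real N * (D.card + 1) := by simp [h1]; ring
        _ ≤ _ := mul_le_mul_of_nonneg_right hbη (by positivity)
    have hpt : ∀ y, J (b fun h => y h, β (y 1), fun f : D => b fun h => y (f * h)) ≤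
        J (a y, β (y 1), fun f : D => a fun h => y (f * h)) + N'.indicator (fun _ => M) y := by
      intro y
      by_cases hy : y ∈ N'
      · rw [Set.indicator_of_mem hy]; exact hM _ _
      · rw [Set.indicator_of_notMem hy, add_zero]
        simp only [N', hN, Set.mem_union, Set.mem_iUnion, Set.mem_preimage, Set.mem_ofPred_eq,
          not_or, not_exists, not_not] at hy
        simp only [hy.1, hy.2, le_refl]
    refine (hmain.trans (integral_mono (f := fun y : G → K =>
      J (b fun h => y h, β (y 1), fun f : D => b fun h => y (f * h)))
      (integrable_comp_of_finite (hJm hb') J)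
      ((integrable_comp_of_finite (hJm ha) J).add
        ((integrable_const M).indicator hN'm)) hpt)).trans ?_
    simp only [Pi.add_apply]
    rw [integral_add (integrable_comp_of_finite (hJm ha) J)
      ((integrable_const M).indicator hN'm), integral_indicator_const M hN'm, smul_eq_mul]
    nlinarith [mul_le_mul_of_nonneg_right hN' hM0]
  have hlim : Tendsto (fun η : ℝ => ∫ y, J (a y, β (y 1), fun f : D => a fun h => y (f * h)) ∂μ +
      η * (M * (D.card + 1))) (𝓝[>] 0)
      (𝓝 (∫ y, J (a y, β (y 1), fun f : D => a fun h => y (f * h)) ∂μ +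
        0 * (M * (D.card + 1)))) :=
    (tendsto_const_nhds.add (tendsto_id.mul_const _)).mono_left nhdsWithin_le_nhds
  rw [zero_mul, add_zero] at hlim
  exact ge_of_tendsto hlim (by filter_upwards [self_mem_nhdsWithin] with η hη using key η hη)

end MeasurableCodes

/-- A measure of finite base entropy is concentrated, up to `ε`, on finitely many atoms. -/
theorem exists_finset_atoms {L : Type*} [MeasurableSpace L] [MeasurableSingletonClass L]
    (l : Measure L) [IsProbabilityMeasure l] (hl : baseEntropy l ≠ ⊤) {ε : ℝ} (hε : 0 < ε) :
    ∃ S : Finset L, (∀ s ∈ S, 0 < l.real {s}) ∧ l.real (S : Set L)ᶜ ≤ ε ∧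
      ∑ s ∈ S, Real.negMulLog (l.real {s}) ≤ (baseEntropy l).toReal := by
  classical
  have hK : ∃ K' : Set L, K'.Countable ∧ l K' = 1 := by
    by_contra h
    exact hl (if_neg h)
  have hH : baseEntropy l = ∑' k : L, ENNReal.ofReal (Real.negMulLog (l.real {k})) := if_pos hK
  have hnn : ∀ k, 0 ≤ Real.negMulLog (l.real {k}) := fun k =>
    Real.negMulLog_nonneg measureReal_nonneg measureReal_le_one
  obtain ⟨K', hK', h1⟩ := hK
  have hsum : ∑' k : K', l {(k : L)} = 1 := by
    rw [← h1, ← setLIntegral_one, lintegral_countable _ hK']; simp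
  have hlt : 1 - ENNReal.ofReal ε < ∑' k : K', l {(k : L)} := by
    rw [hsum]
    exact ENNReal.sub_lt_self ENNReal.one_ne_top one_ne_zero (by simpa using hε)
  rw [ENNReal.tsum_eq_iSup_sum] at hlt
  obtain ⟨T, hT⟩ := lt_iSup_iff.1 hlt
  -- Null points are dropped so that every remaining atom receives a finite code length.
  let S : Finset L := (T.map (Function.Embedding.subtype _)).filter fun k => l {k} ≠ 0
  have hlS : l (S : Set L) = ∑ k ∈ T, l {(k : L)} := by
    rw [← sum_measure_singleton, Finset.sum_filter_ne_zero, Finset.sum_map]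
    rfl
  refine ⟨S, fun s hs => ?_, ?_, ?_⟩
  · exact ENNReal.toReal_pos (Finset.mem_filter.1 hs).2 (measure_ne_top _ _)
  · refine ENNReal.toReal_le_of_le_ofReal hε.le ?_
    rw [prob_compl_eq_one_sub S.measurableSet, tsub_le_iff_left, hlS]
    exact tsub_le_iff_right.1 hT.le
  · rw [← ENNReal.ofReal_le_iff_le_toReal hl, ENNReal.ofReal_sum_of_nonneg fun k _ => hnn k, hH]
    exact ENNReal.sum_le_tsum S

/-! ## Quantization of the base and the entropy inequality -/

section Quantization

variable {L : Type*}

open Classical in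
/-- The map that remembers the points of `S` and lumps the other points together. -/
noncomputable def quantize (S : Finset L) (x : L) : Option S :=
  if h : x ∈ S then some ⟨x, h⟩ else none

theorem quantize_preimage_some (S : Finset L) (s : S) :
    quantize S ⁻¹' {some s} = {(s : L)} := by
  ext x
  simp only [Set.mem_preimage, Set.mem_singleton_iff, quantize]
  split_ifs with h
  · simp [Subtype.ext_iff]
  · simp only [false_iff]
    rintro rfl
    exact h s.2

theorem quantize_preimage_none (S : Finset L) :
    quantize S ⁻¹' {none} = (S : Set L)ᶜ := by
  ext x
  simp only [Set.mem_preimage, Set.mem_singleton_iff, quantize]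
  split_ifs with h <;> simp [h]

theorem getD_quantize {S : Finset L} {x : L} (h : x ∈ S) (x₀ : L) :
    ((quantize S x).map Subtype.val).getD x₀ = x := by
  simp [quantize, h]

variable [MeasurableSpace L]

theorem measurable_quantize [MeasurableSingletonClass L] (S : Finset L) :
    Measurable[_, ⊤] (quantize S) := by
  let _ : MeasurableSpace (Option S) := ⊤
  refine measurable_to_countable' fun o => ?_
  cases o with
  | none => rw [quantize_preimage_none]; exact S.measurableSet.compl
  | some s => rw [quantize_preimage_some]; exact measurableSet_singleton _

/-- A code on `Option S` with lengths close to the optimal ones for the law of `quantize S`. -/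
noncomputable def quantizeCode (l : Measure L) (S : Finset L) (δ : ℝ) : Option S → ℝ
  -- The added `δ` keeps this weight positive even when the complement of `S` is null; the factors
  -- `1 - δ` compensate for it in the total.
  | none => (1 - δ) * l.real (S : Set L)ᶜ + δ
  | some s => (1 - δ) * l.real {(s : L)}

variable {l : Measure L} {S : Finset L} {δ : ℝ}

theorem quantizeCode_pos (hS : ∀ s ∈ S, 0 < l.real {s}) (h0 : 0 < δ) (h1 : δ < 1)
    (o : Option S) : 0 < quantizeCode l S δ o := by
  cases o with
  | none =>
    have : 0 ≤ l.real (S : Set L)ᶜ := measureReal_nonneg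
    have : 0 ≤ (1 - δ) * l.real (S : Set L)ᶜ := mul_nonneg (by linarith) this
    simp only [quantizeCode]; linarith
  | some s => exact mul_pos (by linarith) (hS s s.2)

theorem sum_quantizeCode [MeasurableSingletonClass L] [IsProbabilityMeasure l] :
    ∑ o, quantizeCode l S δ o = 1 := by
  have h : l.real (S : Set L) = ∑ s : S, l.real {(s : L)} := by
    rw [Finset.sum_coe_sort S fun s => l.real {s}, sum_measureReal_singleton]
  have h2 := probReal_compl_eq_one_sub (μ := l) S.measurableSet
  rw [Fintype.sum_option]
  simp only [quantizeCode]
  rw [← Finset.mul_sum, ← h, h2]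
  ring

/-- Atoms in `S` are coded optimally up to `-log (1 - δ)`. The lump costs at most `-log δ`, which is
paid only with the mass of the complement of `S`. -/
theorem integral_quantizeCode_le [MeasurableSingletonClass L] [IsProbabilityMeasure l]
    (hS : ∀ s ∈ S, 0 < l.real {s})
    (h0 : 0 < δ) (h1 : δ < 1) :
    ∫ x, -Real.log (quantizeCode l S δ (quantize S x)) ∂l ≤
      ∑ s ∈ S, Real.negMulLog (l.real {s}) - Real.log (1 - δ) -
        Real.log δ * l.real (S : Set L)ᶜ := by
  let _ : MeasurableSpace (Option S) := ⊤
  rw [integral_comp_of_fintype (measurable_quantize S) fun o => -Real.log (quantizeCode l S δ o),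
    Fintype.sum_option, quantize_preimage_none]
  simp only [quantize_preimage_some, quantizeCode]
  have hc : 0 ≤ l.real (S : Set L)ᶜ := measureReal_nonneg
  have h2 : l.real (S : Set L)ᶜ * -Real.log ((1 - δ) * l.real (S : Set L)ᶜ + δ) ≤
      - Real.log δ * l.real (S : Set L)ᶜ := by
    rw [mul_comm]
    refine mul_le_mul_of_nonneg_right (neg_le_neg (Real.log_le_log h0 ?_)) hc
    have : 0 ≤ (1 - δ) * l.real (S : Set L)ᶜ := mul_nonneg (by linarith) hc
    linarith
  have h3 : ∀ s : S, l.real {(s : L)} * -Real.log ((1 - δ) * l.real {(s : L)}) =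
      Real.negMulLog (l.real {(s : L)}) + l.real {(s : L)} * -Real.log (1 - δ) := fun s => by
    rw [Real.log_mul (by linarith) (hS s s.2).ne', Real.negMulLog]; ring
  simp_rw [h3]
  rw [Finset.sum_add_distrib, ← Finset.sum_mul, Finset.sum_coe_sort S fun s => l.real {s},
    Finset.sum_coe_sort S fun s => Real.negMulLog (l.real {s}), sum_measureReal_singleton]
  have h4 : l.real (S : Set L) * -Real.log (1 - δ) ≤ 1 * -Real.log (1 - δ) :=
    mul_le_mul_of_nonneg_right measureReal_le_one
      (neg_nonneg.2 (Real.log_nonpos (by linarith) (by linarith)))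
  linarith

end Quantization

/-! ### Coding the corrections to a guess -/

section Correction

variable {B : Type*} [Fintype B] {δ : ℝ}

open Classical in
/-- The code for a letter `x` given the guess `b` for it. -/
noncomputable def correctionCode (B : Type*) [Fintype B] (δ : ℝ) (x b : B) : ℝ :=
  -- A mixture of the point mass at the guess, with weight `1 - δ`, and the uniform law, with weight
  -- `δ`.
  if x = b then 1 - δ + δ / Fintype.card B else δ / Fintype.card B

theorem correctionCode_pos (h0 : 0 < δ) (h1 : δ < 1) (x b : B) : 0 < correctionCode B δ x b := by
  have : Nonempty B := ⟨x⟩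
  have : 0 < δ / Fintype.card B := div_pos h0 (by exact_mod_cast Fintype.card_pos)
  rw [correctionCode]
  split_ifs <;> linarith

theorem sum_correctionCode (b : B) : ∑ x, correctionCode B δ x b = 1 := by
  classical
  have : Nonempty B := ⟨b⟩
  have hc : (Fintype.card B : ℝ) ≠ 0 := by exact_mod_cast Fintype.card_ne_zero
  have : ∀ x, correctionCode B δ x b = (if x = b then 1 - δ else 0) + δ / Fintype.card B := by
    intro x; rw [correctionCode]; split_ifs <;> simp
  simp_rw [this]
  rw [Finset.sum_add_distrib, Finset.sum_ite_eq' Finset.univ b]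
  simp
  field_simp
  ring

theorem neg_log_correctionCode_le (h0 : 0 < δ) (h1 : δ < 1) (x b : B) :
    -Real.log (correctionCode B δ x b) ≤ -Real.log (1 - δ) +
      {p : B × B | p.1 ≠ p.2}.indicator (fun _ => -Real.log (δ / Fintype.card B)) (x, b) := by
  have : Nonempty B := ⟨x⟩
  have hpos : 0 < δ / Fintype.card B := div_pos h0 (by exact_mod_cast Fintype.card_pos)
  by_cases h : x = b
  · rw [Set.indicator_of_notMem (by simpa using h), correctionCode, if_pos h, add_zero]
    exact neg_le_neg (Real.log_le_log (by linarith) (by linarith))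
  · rw [Set.indicator_of_mem (by simpa using h), correctionCode, if_neg h]
    have := Real.log_nonpos (x := 1 - δ) (by linarith) (by linarith)
    linarith

end Correction

/-- A function of the `L`-process is approximated by a function of finitely many quantized
coordinates. -/
theorem exists_quantized_window_approx {G L B : Type*} [MeasurableSpace L]
    [MeasurableSingletonClass L] [MeasurableSpace B] [MeasurableSingletonClass B] [Fintype B]
    (l : Measure L) [IsProbabilityMeasure l]
    {b : (G → L) → B} (hb : Measurable b) {ε : ℝ} (hε : 0 < ε) :
    ∃ D : Finset G, ∀ S : Finset L, ∃ c : (D → Option S) → B,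
      (Measure.infinitePi fun _ : G => l).real {x | b x ≠ c fun f => quantize S (x f)} ≤
        ε + D.card * l.real (S : Set L)ᶜ := by
  set ν := Measure.infinitePi fun _ : G => l with hν
  obtain ⟨D, c, -, hcε⟩ := exists_window_approx ν hb hε
  obtain ⟨x₀⟩ : Nonempty L := nonempty_of_isProbabilityMeasure l
  -- Lumped letters are decoded as `x₀`, which can be wrong only if some coordinate in `D` leaves
  -- `S`.
  refine ⟨D, fun S => ⟨fun u => c fun f => ((u f).map Subtype.val).getD x₀, ?_⟩⟩
  have hsub : {x : G → L | b x ≠ c fun f => ((quantize S (x f)).map Subtype.val).getD x₀} ⊆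
      {x | b x ≠ c fun f => x f} ∪ ⋃ f : D, (fun x : G → L => x f) ⁻¹' (S : Set L)ᶜ := by
    intro x hx
    by_contra hcon
    simp only [Set.mem_union, Set.mem_iUnion, Set.mem_preimage, Set.mem_compl_iff,
      Finset.mem_coe, Set.mem_ofPred_eq, not_or, not_not, not_exists] at hcon
    apply hx
    rw [hcon.1]
    congr 1
    funext f
    rw [getD_quantize (hcon.2 f)]
  have hf : ∀ f : D, ν.real ((fun x : G → L => x f) ⁻¹' (S : Set L)ᶜ) = l.real (S : Set L)ᶜ :=
    fun f => (measurePreserving_eval_infinitePi (fun _ : G => l) (f : G)).measureReal_preimage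
      S.measurableSet.compl.nullMeasurableSet
  refine (measureReal_mono hsub).trans ((measureReal_union_le _ _).trans
    (add_le_add hcε ((measureReal_iUnion_fintype_le _).trans_eq ?_)))
  rw [Finset.sum_congr rfl fun f _ => hf f]
  simp

/-! ### The entropy inequality for Bernoulli shifts -/

section Main

variable {G K L B : Type*} [Group G] [MeasurableSpace K] [MeasurableSpace L]
  [MeasurableSingletonClass L]
  [MeasurableSpace B] [MeasurableSingletonClass B] [Fintype B]

/-- The entropy inequality: if the `K`-process can be recovered from the `L`-process `Ψ` coded from
it, then the entropy of any finite partition of `K` is at most the entropy of `L`. -/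
theorem partitionEntropy_le_baseEntropy (hG : IsSofic G) (κ : Measure K) [IsProbabilityMeasure κ]
    (l : Measure L) [IsProbabilityMeasure l] (hl : baseEntropy l ≠ ⊤)
    {β : K → B} (hβ : Measurable β) {Ψ : (G → K) → G → L} {Φ : (G → L) → G → K}
    (hΨ : MeasurePreserving Ψ (Measure.infinitePi fun _ : G => κ)
      (Measure.infinitePi fun _ : G => l)) (hΦ : Measurable Φ)
    (hΦΨ : ∀ᵐ y ∂(Measure.infinitePi fun _ : G => κ), Φ (Ψ y) = y)
    (hequiv : ∀ f : G, ∀ᵐ y ∂(Measure.infinitePi fun _ : G => κ),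
      Ψ y f = Ψ (fun h => y (f * h)) 1) :
    partitionEntropy κ β ≤ (baseEntropy l).toReal := by
  classical
  set μ := Measure.infinitePi fun _ : G => κ with hμ
  set ν := Measure.infinitePi fun _ : G => l with hν
  refine le_of_forall_pos_le_add fun τ hτ => ?_
  -- Chosen so that `-log (1 - δ) = τ / 6`; this loss occurs twice, once in each code.
  let δ : ℝ := 1 - Real.exp (-(τ / 6))
  have hδ1 : δ < 1 := by have := Real.exp_pos (-(τ / 6)); simp only [δ]; linarith
  have hδ0 : 0 < δ := by
    have : Real.exp (-(τ / 6)) < 1 := by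
      rw [← Real.exp_zero]; exact Real.exp_lt_exp.2 (by linarith)
    simp only [δ]; linarith
  have hδlog : -Real.log (1 - δ) = τ / 6 := by simp [δ]
  obtain ⟨k₀⟩ : Nonempty K := nonempty_of_isProbabilityMeasure κ
  have : Nonempty B := ⟨β k₀⟩
  set N : ℝ := -Real.log (δ / Fintype.card B) with hN
  have hN0 : 0 ≤ N := by
    refine neg_nonneg.2 (Real.log_nonpos (by positivity) ?_)
    have : (1 : ℝ) ≤ Fintype.card B := by exact_mod_cast Fintype.card_pos
    rw [div_le_one (by linarith)]
    linarith
  have hδ' : 0 ≤ -Real.log δ := neg_nonneg.2 (Real.log_nonpos hδ0.le hδ1.le)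
  let b : (G → L) → B := fun x => β (Φ x 1)
  have hb : Measurable b := hβ.comp ((measurable_pi_apply 1).comp hΦ)
  -- `N` bounds the extra cost of a wrong guess. The decoding window `D` is fixed before `S`, so the
  -- tail of `S` can be made small relative to `N * D.card`. The approximation error and the tail
  -- then cost at most `τ / 3` each.
  obtain ⟨D, hD⟩ := exists_quantized_window_approx l hb (ε := τ / 3 / (N + 1)) (by positivity)
  obtain ⟨S, hSpos, hScompl, hSsum⟩ := exists_finset_atoms l hl
    (ε := τ / 3 / (-Real.log δ + N * D.card + 1)) (by positivity)
  obtain ⟨c, hc⟩ := hD S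
  let _ : MeasurableSpace (Option S) := ⊤
  have hq : Measurable (quantize S) := measurable_quantize S
  have hΨ1 : MeasurePreserving (fun y => Ψ y 1) μ l :=
    (measurePreserving_eval_infinitePi (fun _ : G => l) (1 : G)).comp hΨ
  let a : (G → K) → Option S := fun y => quantize S (Ψ y 1)
  have ha : Measurable a := hq.comp hΨ1.measurable
  have hshift := measurePreserving_mul_left_infinitePi (G := G) κ
  have hmain := partitionEntropy_le_of_isSofic_of_measurable hG κ hβ
    (quantizeCode_pos hSpos hδ0 hδ1) sum_quantizeCode.le (correctionCode_pos hδ0 hδ1)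
    (fun b => (sum_correctionCode b).le) ha c
  have hguess : Measurable fun y : G → K =>
      ((β (y 1), c fun f => a fun h => y (f * h)) : B × B) :=
    (hβ.comp (measurable_pi_apply 1)).prodMk ((measurable_of_finite c).comp
      (measurable_pi_lambda _ fun f => ha.comp (hshift f).measurable))
  have hi1 := integrable_comp_of_finite (P := μ) ha fun o => -Real.log (quantizeCode l S δ o)
  have hi2 := integrable_comp_of_finite (P := μ) hguess
    fun p => Real.log (correctionCode B δ p.1 p.2)
  rw [integral_sub hi1 hi2] at hmain
  have hfirst : ∫ y, -Real.log (quantizeCode l S δ (a y)) ∂μ =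
      ∫ x, -Real.log (quantizeCode l S δ (quantize S x)) ∂l := by
    have h := integral_map (μ := μ) hΨ1.measurable.aemeasurable
      (f := fun x => -Real.log (quantizeCode l S δ (quantize S x)))
      ((measurable_of_finite fun o => -Real.log (quantizeCode l S δ o)).comp
        hq).aestronglyMeasurable
    rw [← h, hΨ1.map_eq]
  let bad : Set (G → K) := {y | β (y 1) ≠ c fun f => a fun h => y (f * h)}
  have hbadm : MeasurableSet bad :=
    hguess (t := {p : B × B | p.1 ≠ p.2}) (Set.toFinite _).measurableSet
  have hbad : μ.real bad ≤ τ / 3 / (N + 1) + D.card * l.real (S : Set L)ᶜ := by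
    let bad' : Set (G → L) := {x | b x ≠ c fun f => quantize S (x f)}
    have hbadm' : MeasurableSet bad' := by
      have : Measurable fun x : G → L => c fun f : D => quantize S (x f) :=
        (measurable_of_finite c).comp
          (measurable_pi_lambda _ fun f => hq.comp (measurable_pi_apply _))
      exact (measurableSet_eq_fun hb this).compl
    rw [← hΨ.measureReal_preimage hbadm'.nullMeasurableSet] at hc
    refine le_trans (le_of_eq ?_) hc
    -- By equivariance the letters read along `y` are the quantized coordinates of `Ψ y`, and `Φ`
    -- recovers `y` from `Ψ y`; so wrong guesses are the preimage under `Ψ` of the decoding errors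
    -- in the `L`-process.
    refine measureReal_congr ?_
    have hall : ∀ᵐ y ∂μ, ∀ f : D, Ψ y f = Ψ (fun h => y (f * h)) 1 :=
      ae_all_iff.2 fun f => hequiv f
    filter_upwards [hΦΨ, hall] with y hy1 hy2
    refine propext ?_
    change (β (y 1) ≠ c fun f => quantize S (Ψ (fun h => y (f * h)) 1)) ↔
      (β (Φ (Ψ y) 1) ≠ c fun f => quantize S (Ψ y f))
    simp only [hy1, hy2]
  have hsecond : -∫ y, Real.log
      (correctionCode B δ (β (y 1)) (c fun f => a fun h => y (f * h))) ∂μ ≤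
      -Real.log (1 - δ) + N * μ.real bad := by
    rw [← integral_neg]
    refine (integral_mono (g := fun y => -Real.log (1 - δ) + bad.indicator (fun _ => N) y) hi2.neg
      ((integrable_const _).add ((integrable_const N).indicator hbadm))
      fun y => neg_log_correctionCode_le hδ0 hδ1 _ _).trans_eq ?_
    rw [integral_add (integrable_const _) ((integrable_const N).indicator hbadm),
      integral_indicator_const N hbadm]
    simp [mul_comm]
  have hquant := integral_quantizeCode_le (l := l) hSpos hδ0 hδ1
  have hlS : 0 ≤ l.real (S : Set L)ᶜ := measureReal_nonneg
  have e1 : N * (τ / 3 / (N + 1)) ≤ τ / 3 := by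
    rw [mul_div_assoc', div_le_iff₀ (by linarith)]
    nlinarith
  have hden : 0 < -Real.log δ + N * D.card + 1 := by positivity
  have e2 : (-Real.log δ + N * D.card) * l.real (S : Set L)ᶜ ≤ τ / 3 := by
    rw [le_div_iff₀ hden] at hScompl
    nlinarith
  have e3 := mul_le_mul_of_nonneg_left hbad hN0
  rw [hfirst] at hmain
  nlinarith

end Main

/-! ## Conjugacies -/

section Conjugacy

variable {G X X₂ Y : Type*} [Group G] [MeasurableSpace X] [MulAction G X]
  [MeasurableSpace X₂] [MulAction G X₂] [MeasurableSpace Y] [MulAction G Y]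

/-- Invariance is required only of `X'`; that of `Y'` follows because `g • φ x` is again a value of
`φ`. -/
theorem IsMeasurablyConjugate.symm {μ : Measure X} {ν : Measure Y}
    (h : IsMeasurablyConjugate G μ ν) : IsMeasurablyConjugate G ν μ := by
  obtain ⟨X', Y', hX', hY', hμ, hν, φ, hφ, heq⟩ := h
  refine ⟨Y', X', hY', hX', hν, hμ, φ.symm, hφ.symm φ, fun g y => ?_⟩
  obtain ⟨hg, hgφ⟩ := heq g (φ.symm y)
  rw [φ.apply_symm_apply] at hgφ
  have hmem : g • (y : Y) ∈ Y' := hgφ ▸ (φ _).2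
  refine ⟨hmem, ?_⟩
  have : (⟨g • (y : Y), hmem⟩ : Y') = φ ⟨g • (φ.symm y : X), hg⟩ := Subtype.ext hgφ.symm
  rw [this, φ.symm_apply_apply]

theorem IsMeasurablyConjugate.comp_measurableEquiv {μ : Measure X} {μ₂ : Measure X₂}
    {ν : Measure Y} (h : IsMeasurablyConjugate G μ₂ ν) (e : X ≃ᵐ X₂) (he : MeasurePreserving e μ μ₂)
    (hequiv : ∀ (g : G) x, e (g • x) = g • e x) : IsMeasurablyConjugate G μ ν := by
  obtain ⟨X', Y', hX', hY', hμ, hν, φ, hφ, heq⟩ := h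
  let r : (e ⁻¹' X' : Set X) ≃ᵐ X' :=
    { toFun := fun x => ⟨e x, x.2⟩
      invFun := fun x => ⟨e.symm x, by simp⟩
      left_inv := fun x => by simp
      right_inv := fun x => by simp
      measurable_toFun := (e.measurable.comp measurable_subtype_coe).subtype_mk
      measurable_invFun := Measurable.subtype_mk (h := fun x => by simp)
        (e.symm.measurable.comp measurable_subtype_coe) }
  have hr : MeasurePreserving r (μ.comap Subtype.val) (μ₂.comap Subtype.val) := by
    refine ⟨r.measurable, Measure.ext fun s hs => ?_⟩
    rw [Measure.map_apply r.measurable hs, comap_subtype_coe_apply (e.measurable hX'),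
      comap_subtype_coe_apply hX', ← he.measure_preimage
        (hX'.subtype_image hs).nullMeasurableSet]
    congr 1
    ext x
    simp only [Set.mem_image, Set.mem_preimage, Subtype.exists, exists_and_right, exists_eq_right]
    rfl
  refine ⟨e ⁻¹' X', Y', e.measurable hX', hY', ?_, hν, r.trans φ, hφ.comp hr, fun g x => ?_⟩
  · rw [← Set.preimage_compl, he.measure_preimage hX'.compl.nullMeasurableSet, hμ]
  · obtain ⟨hg, hgφ⟩ := heq g (r x)
    have hmem : g • (x : X) ∈ e ⁻¹' X' := by
      rw [Set.mem_preimage, hequiv]; exact hg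
    refine ⟨hmem, ?_⟩
    rw [MeasurableEquiv.trans_apply, MeasurableEquiv.trans_apply, ← hgφ]
    congr 2
    exact Subtype.ext (hequiv g x)

theorem measurePreserving_subtype_val_of_compl_null {μ : Measure X} {X' : Set X}
    (hX' : MeasurableSet X') (h : μ X'ᶜ = 0) :
    MeasurePreserving (Subtype.val : X' → X) (μ.comap Subtype.val) μ :=
  ⟨measurable_subtype_coe, by
    rw [map_comap_subtype_coe hX', Measure.restrict_eq_self_of_ae_mem (mem_ae_iff.2 h)]⟩

/-- A conjugacy gives globally defined measurable maps that are mutually inverse and equivariant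
almost everywhere. -/
theorem IsMeasurablyConjugate.exists_maps {μ : Measure X} {ν : Measure Y} [IsProbabilityMeasure μ]
    [IsProbabilityMeasure ν] (h : IsMeasurablyConjugate G μ ν) :
    ∃ (Ψ : X → Y) (Φ : Y → X), MeasurePreserving Ψ μ ν ∧ Measurable Φ ∧ (∀ᵐ x ∂μ, Φ (Ψ x) = x) ∧
      ∀ᵐ x ∂μ, ∀ g : G, Ψ (g • x) = g • Ψ x := by
  classical
  obtain ⟨X', Y', hX', hY', hμ, hν, φ, hφ, heq⟩ := h
  obtain ⟨x₀⟩ : Nonempty X := nonempty_of_isProbabilityMeasure μ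
  obtain ⟨y₀⟩ : Nonempty Y := nonempty_of_isProbabilityMeasure ν
  -- The constant values off the conull sets never matter, as all conclusions hold almost
  -- everywhere.
  let Ψ : X → Y := fun x => if hx : x ∈ X' then φ ⟨x, hx⟩ else y₀
  let Φ : Y → X := fun y => if hy : y ∈ Y' then φ.symm ⟨y, hy⟩ else x₀
  have hΨm : Measurable Ψ := Measurable.dite (f := fun x : X' => (φ x : Y))
    (g := fun _ => y₀) (measurable_subtype_coe.comp φ.measurable) measurable_const hX'
  have hΦm : Measurable Φ := Measurable.dite (f := fun y : Y' => (φ.symm y : X))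
    (g := fun _ => x₀) (measurable_subtype_coe.comp φ.symm.measurable) measurable_const hY'
  have hΨφ : ∀ x : X', Ψ x = φ x := fun x => dif_pos x.2
  have hX'ae : ∀ᵐ x ∂μ, x ∈ X' := mem_ae_iff.2 hμ
  refine ⟨Ψ, Φ, ⟨hΨm, ?_⟩, hΦm, ?_, ?_⟩
  · rw [← (measurePreserving_subtype_val_of_compl_null hX' hμ).map_eq,
      Measure.map_map hΨm measurable_subtype_coe,
      ← ((measurePreserving_subtype_val_of_compl_null hY' hν).comp hφ).map_eq]
    congr 1
    exact funext hΨφ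
  · filter_upwards [hX'ae] with x hx
    have h1 : Ψ x = φ ⟨x, hx⟩ := hΨφ ⟨x, hx⟩
    rw [h1]
    change dite _ _ _ = x
    rw [dif_pos (φ ⟨x, hx⟩).2]
    simp
  · filter_upwards [hX'ae] with x hx g
    obtain ⟨hg, hgφ⟩ := heq g ⟨x, hx⟩
    rw [hΨφ ⟨x, hx⟩, ← hgφ]
    exact hΨφ ⟨g • x, hg⟩

end Conjugacy

/-! ## Bernoulli shifts -/

instance isProbabilityMeasure_bernoulliMeasure (G : Type*) {K : Type*} [MeasurableSpace K]
    (κ : Measure K) [IsProbabilityMeasure κ] : IsProbabilityMeasure (bernoulliMeasure G κ) :=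
  inferInstanceAs (IsProbabilityMeasure (Measure.infinitePi fun _ : G => κ))

/-- A strict reverse inequality would make the entropy of `l` finite and give a finite partition of
`K` of larger entropy, against `partitionEntropy_le_baseEntropy`. -/
theorem baseEntropy_le_of_isMeasurablyConjugate {G K L : Type*} [Group G] (hG : IsSofic G)
    [MeasurableSpace K] [StandardBorelSpace K] [MeasurableSpace L] [MeasurableSingletonClass L]
    (κ : Measure K) [IsProbabilityMeasure κ] (l : Measure L) [IsProbabilityMeasure l]
    (h : IsMeasurablyConjugate G (bernoulliMeasure G κ) (bernoulliMeasure G l)) :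
    baseEntropy κ ≤ baseEntropy l := by
  by_contra! hlt
  obtain ⟨n, β, hβ, hn⟩ := exists_lt_partitionEntropy κ hlt
  obtain ⟨Ψ, Φ, hΨ, hΦ, hΦΨ, hequiv⟩ := h.exists_maps
  have hle : partitionEntropy κ β ≤ (baseEntropy l).toReal := by
    refine partitionEntropy_le_baseEntropy hG κ l hlt.ne_top hβ hΨ hΦ hΦΨ fun f =>
      hequiv.mono fun (y : BernoulliSpace G K) hy => ?_
    -- Acting by `f⁻¹` is the translation `y (f * ·)` of the coding argument.
    have h1 : f⁻¹ • y = fun h => y (f * h) := by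
      change (fun h => y (f⁻¹⁻¹ * h)) = _
      rw [inv_inv]
    have h2 : (f⁻¹ • Ψ y) 1 = Ψ y f := by
      change Ψ y (f⁻¹⁻¹ * 1) = _
      rw [inv_inv, mul_one]
    rw [← h2, ← hy, h1]
  exact hn.not_ge (ENNReal.ofReal_le_of_le_toReal hle)

/-! ### Change of base along a Borel isomorphism -/

section Transfer

variable {K K' : Type*} [MeasurableSpace K] [MeasurableSpace K']
  (κ : Measure K) (e : K ≃ᵐ K')

theorem baseEntropy_map : baseEntropy (κ.map e) = baseEntropy κ := by
  have hex : (∃ S : Set K', S.Countable ∧ κ.map e S = 1) ↔ ∃ S : Set K, S.Countable ∧ κ S = 1 := by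
    constructor
    · rintro ⟨S, hS, h1⟩
      exact ⟨e ⁻¹' S, hS.preimage e.injective, by rw [← h1, e.map_apply]⟩
    · rintro ⟨S, hS, h1⟩
      exact ⟨e '' S, hS.image e, by rw [e.map_apply, Set.preimage_image_eq _ e.injective, h1]⟩
  have hsum : ∑' k : K', ENNReal.ofReal (Real.negMulLog ((κ.map e).real {k})) =
      ∑' k : K, ENNReal.ofReal (Real.negMulLog (κ.real {k})) := by
    rw [← e.toEquiv.tsum_eq]
    refine tsum_congr fun k => ?_
    rw [measureReal_def, measureReal_def, e.map_apply]
    congr 4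
    ext x
    simp
  rw [baseEntropy, baseEntropy]
  split_ifs with h1 h2 h2
  · exact hsum
  · exact absurd (hex.1 h1) h2
  · exact absurd (hex.2 h2) h1
  · rfl

theorem IsMeasurablyConjugate.of_map_base {G Y : Type*} [Group G] [MeasurableSpace Y]
    [MulAction G Y] [IsProbabilityMeasure κ] [IsProbabilityMeasure (κ.map e)] {ν : Measure Y}
    (h : IsMeasurablyConjugate G (bernoulliMeasure G (κ.map e)) ν) :
    IsMeasurablyConjugate G (bernoulliMeasure G κ) ν := by
  let E : BernoulliSpace G K ≃ᵐ BernoulliSpace G K' := MeasurableEquiv.piCongrRight fun _ => e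
  refine h.comp_measurableEquiv E ⟨E.measurable, ?_⟩ fun g x => rfl
  exact Measure.infinitePi_map_pi (μ := fun _ : G => κ) fun _ => e.measurable

end Transfer

/-- A standard Borel space is Borel isomorphic to one in `Type`. -/
theorem exists_measurableEquiv_type (K : Type*) [MeasurableSpace K] [StandardBorelSpace K] :
    ∃ (K' : Type) (_ : MeasurableSpace K') (_ : StandardBorelSpace K'), Nonempty (K ≃ᵐ K') := by
  have h := measurableEmbedding_embeddingReal K
  exact ⟨Set.range (embeddingReal K), inferInstance, h.measurableSet_range.standardBorel,
    ⟨h.equivRange⟩⟩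

/-- Removes the universe restriction in `IsOrnstein`: both bases are replaced by Borel copies in
`Type`, which changes neither the entropies nor the conjugacy classes of the shifts. -/
theorem IsOrnstein.isMeasurablyConjugate {G : Type*} [Group G] (hG : IsOrnstein G)
    {K₁ : Type*} [MeasurableSpace K₁] [StandardBorelSpace K₁]
    {K₂ : Type*} [MeasurableSpace K₂] [StandardBorelSpace K₂]
    (κ₁ : Measure K₁) [IsProbabilityMeasure κ₁] (κ₂ : Measure K₂) [IsProbabilityMeasure κ₂]
    (h : baseEntropy κ₁ = baseEntropy κ₂) :
    IsMeasurablyConjugate G (bernoulliMeasure G κ₁) (bernoulliMeasure G κ₂) := by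
  obtain ⟨L₁, _, _, ⟨e₁⟩⟩ := exists_measurableEquiv_type K₁
  obtain ⟨L₂, _, _, ⟨e₂⟩⟩ := exists_measurableEquiv_type K₂
  have := Measure.isProbabilityMeasure_map (μ := κ₁) e₁.measurable.aemeasurable
  have := Measure.isProbabilityMeasure_map (μ := κ₂) e₂.measurable.aemeasurable
  have hL := hG L₁ L₂ (κ₁.map e₁) (κ₂.map e₂) (by rw [baseEntropy_map, baseEntropy_map, h])
  exact (IsMeasurablyConjugate.of_map_base κ₂ e₂
    (IsMeasurablyConjugate.of_map_base κ₁ e₁ hL).symm).symm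

theorem mainTheorem4 {G : Type*} [Group G] [Countable G] (hsofic : IsSofic G)
    (hornstein : IsOrnstein G)
    {K₁ : Type*} [MeasurableSpace K₁] [StandardBorelSpace K₁]
    {K₂ : Type*} [MeasurableSpace K₂] [StandardBorelSpace K₂]
    (κ₁ : Measure K₁) [IsProbabilityMeasure κ₁] (κ₂ : Measure K₂) [IsProbabilityMeasure κ₂] :
    IsMeasurablyConjugate G (bernoulliMeasure G κ₁) (bernoulliMeasure G κ₂) ↔
      baseEntropy κ₁ = baseEntropy κ₂ :=
  ⟨fun h => le_antisymm (baseEntropy_le_of_isMeasurablyConjugate hsofic κ₁ κ₂ h)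
    (baseEntropy_le_of_isMeasurablyConjugate hsofic κ₂ κ₁ h.symm),
    hornstein.isMeasurablyConjugate κ₁ κ₂⟩
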